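/- Let $n\ge 1$, let $M$ be a smooth manifold, and let $\omega\in\Omega^{n+1}(M)$ be closed, so that $(M,\omega)$ is a pre-$n$-plectic manifold. A form $\alpha\in\Omega^{n-1}(M)$ is Hamiltonian if there is a vector field $v_\alpha$ (a Hamiltonian vector field for $\alpha$) with $d\alpha=-\iota_{v_\alpha}\omega$. The Lie $n$-algebra of observables $L_\infty(M,\omega)$ is the graded vector space $L=\bigoplus_{i=0}^{n-1}L_i$ with $L_0=\Omega^{n-1}_{Ham}(M)$ the space of Hamiltonian forms and $L_i=\Omega^{n-1-i}(M)$ for $0<i\le n-1$, together with the multilinear brackets $l_k$, $k\ge 1$, given as follows on homogeneous elements: $l_1(\alpha)=d\alpha$ if $\deg\alpha>0$ and $l_1(\alpha)=0$ if $\deg\alpha=0$; for $k\ge 2$, $l_k(\alpha_1,\dots,\alpha_k)=-(-1)^{k(k+1)/2}\,\iota_{v_{\alpha_k}}\cdots\iota_{v_{\alpha_1}}\omega$ if all $\alpha_j$ have degree $0$, where $v_{\alpha_j}$ is any Hamiltonian vector field for $\alpha_j$ (the result does not depend on the choice), and $l_k(\alpha_1,\dots,\alpha_k)=0$ otherwise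 (so $l_k=0$ for $k>n+1$). An $L_\infty$-subalgebra of $L_\infty(M,\omega)$ is a graded linear subspace closed under all the brackets $l_k$. Let $v$ be a vector field on $M$ with $\mathcal L_v\omega=0$. Let $\mathcal C_{loc}(v)$, $\mathcal C(v)$ and $\mathcal C_{str}(v)$ be the graded vector spaces of the forms $\alpha\in\Omega^\bullet(M)$ for which $\mathcal L_v\alpha$ is closed, exact and zero, respectively (the locally, globally and strictly conserved quantities). Then $$L_\infty(M,\omega)\cap\mathcal C_{loc}(v),\qquad L_\infty(M,\omega)\cap\mathcal C(v),\qquad L_\infty(M,\omega)\cap\mathcal C_{str}(v)$$ are $L_\infty$-subalgebras of $L_\infty(M,\omega)$. Moreover, $\mathcal L_v\bigl(l_k(\beta_1,\dots,\beta_k)\bigr)=0$ for all $k\ge 1$ and all $\beta_1,\dots,\beta_k\in L_\infty(M,\omega)\cap\mathcal C_{loc}(v)$. -/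

import Mathlib

open scoped Manifold Topology

noncomputable section

namespace Multisymplectic

/-! ### Linear algebra of alternating forms on one vector space -/

section Linear

variable {V : Type*} [AddCommGroup V] [Module ℝ V] [TopologicalSpace V]

/-- Contraction of an alternating form with a vector in the first slot:
`(contractVec a f) (w₁, …, w_p) = f (a, w₁, …, w_p)`. -/
def contractVec {p : ℕ} (a : V) (f : V [⋀^Fin (p + 1)]→L[ℝ] ℝ) : V [⋀^Fin p]→L[ℝ] ℝ :=
  { f.toAlternatingMap.curryLeft a with
    cont := f.cont.comp
      (show Continuous fun w : Fin p → V => (Fin.cons a w : Fin (p + 1) → V) from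
        continuous_const.finCons continuous_id) }

theorem contractVec_apply {p : ℕ} (a : V) (f : V [⋀^Fin (p + 1)]→L[ℝ] ℝ) (w : Fin p → V) :
    contractVec a f w = f (Fin.cons a w) := rfl

/-- The derivation action of an endomorphism `A` on an alternating form:
`(derivAct A f) (w₁, …, w_p) = ∑ i, f (w₁, …, A wᵢ, …, w_p)`. -/
def derivAct {p : ℕ} (A : V →L[ℝ] V) (f : V [⋀^Fin p]→L[ℝ] ℝ) : V [⋀^Fin p]→L[ℝ] ℝ :=
  { ∑ i : Fin p, f.toContinuousMultilinearMap.compContinuousLinearMap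
      (fun j => if j = i then A else ContinuousLinearMap.id ℝ V) with
    map_eq_zero_of_eq' := by
      intro w a b hab hne
      have key : ∀ i : Fin p, (fun j => (if j = i then A else ContinuousLinearMap.id ℝ V) (w j))
          = Function.update w i (A (w i)) := by
        intro i
        funext j
        by_cases h : j = i
        · subst h; simp
        · simp [h]
      have hsum : ∑ i : Fin p, f (Function.update w i (A (w i))) = 0 := by
        rw [← Finset.add_sum_erase _ _ (Finset.mem_univ a),
          ← Finset.add_sum_erase _ _ (Finset.mem_erase.2 ⟨hne.symm, Finset.mem_univ b⟩),
          Finset.sum_eq_zero, add_zero]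
        · have hs : Function.update w b (A (w b))
              = Function.update w a (A (w a)) ∘ Equiv.swap a b := by
            funext j
            by_cases h1 : j = a
            · subst h1; simp [hne, hne.symm, hab]
            · by_cases h2 : j = b
              · subst h2; simp [hab]
              · simp [h1, h2, Equiv.swap_apply_of_ne_of_ne h1 h2]
          have := f.toAlternatingMap.map_swap (Function.update w a (A (w a))) hne
          rw [hs]
          simp only [ContinuousAlternatingMap.coe_toAlternatingMap] at this
          rw [this, add_neg_cancel]
        · intro i hi
          simp only [Finset.mem_erase, Finset.mem_univ, and_true] at hi
          refine f.map_eq_zero_of_eq _ (i := a) (j := b) ?_ hne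
          rw [Function.update_of_ne (Ne.symm hi.2), Function.update_of_ne (Ne.symm hi.1), hab]
      simpa [key] using hsum }

theorem derivAct_apply {p : ℕ} (A : V →L[ℝ] V) (f : V [⋀^Fin p]→L[ℝ] ℝ) (w : Fin p → V) :
    derivAct A f w = ∑ i, f (Function.update w i (A (w i))) := by
  have key : ∀ i : Fin p, (fun j => (if j = i then A else ContinuousLinearMap.id ℝ V) (w j))
      = Function.update w i (A (w i)) := by
    intro i
    funext j
    by_cases h : j = i
    · subst h; simp
    · simp [h]
  change (∑ i : Fin p, f.toContinuousMultilinearMap.compContinuousLinearMap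
      (fun j => if j = i then A else ContinuousLinearMap.id ℝ V)) w = _
  simp [key]

end Linear

/-! ### Vector fields and differential forms on a manifold modelled on `E` -/

section Manifold

variable (E : Type*) [NormedAddCommGroup E] [NormedSpace ℝ E]
  (M : Type*) [TopologicalSpace M] [ChartedSpace E M]

/-- Not necessarily smooth vector fields on `M`. -/
abbrev VField : Type _ := ∀ x : M, TangentSpace 𝓘(ℝ, E) x

/-- Not necessarily smooth differential forms of degree `p` on `M`. -/
abbrev DForm (p : ℕ) : Type _ := ∀ x : M, (TangentSpace 𝓘(ℝ, E) x) [⋀^Fin p]→L[ℝ] ℝ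

/-- Not necessarily homogeneous forms, given by their components of all degrees. -/
abbrev GForm : Type _ := ∀ p : ℕ, DForm E M p

variable {E M}

/-- Smooth vector fields: smooth sections of the tangent bundle. -/
def VField.IsSmooth [IsManifold 𝓘(ℝ, E) ((⊤ : ℕ∞) : WithTop ℕ∞) M] (v : VField E M) : Prop :=
  ContMDiff 𝓘(ℝ, E) 𝓘(ℝ, E).tangent ((⊤ : ℕ∞) : WithTop ℕ∞)
    (fun x => (⟨x, v x⟩ : TangentBundle 𝓘(ℝ, E) M))

/-- The coordinate expression of a form in the chart around `x₀`: its pullback under the inverse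
of the chart. It is meaningful on the target of the chart. -/
def DForm.coord {p : ℕ} (α : DForm E M p) (x₀ : M) (y : E) : E [⋀^Fin p]→L[ℝ] ℝ :=
  (α ((extChartAt 𝓘(ℝ, E) x₀).symm y)).compContinuousLinearMap
    (mfderiv 𝓘(ℝ, E) 𝓘(ℝ, E) (extChartAt 𝓘(ℝ, E) x₀).symm y)

/-- The coordinate expression of a vector field in the chart around `x₀`: its pushforward under
the chart. It is meaningful on the target of the chart. -/
def VField.coord (v : VField E M) (x₀ : M) (y : E) : E :=
  mfderiv 𝓘(ℝ, E) 𝓘(ℝ, E) (extChartAt 𝓘(ℝ, E) x₀) ((extChartAt 𝓘(ℝ, E) x₀).symm y)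
    (v ((extChartAt 𝓘(ℝ, E) x₀).symm y))

/-- The value at `x₀` of a form whose coordinate expression, in the chart around `x₀`, takes the
value `f` at the point corresponding to `x₀`. -/
def ofCoordAt {p : ℕ} (x₀ : M) (f : E [⋀^Fin p]→L[ℝ] ℝ) :
    (TangentSpace 𝓘(ℝ, E) x₀) [⋀^Fin p]→L[ℝ] ℝ :=
  f.compContinuousLinearMap (mfderiv 𝓘(ℝ, E) 𝓘(ℝ, E) (extChartAt 𝓘(ℝ, E) x₀) x₀)

/-- Smooth forms: the coordinate expressions are smooth. -/
def DForm.IsSmooth {p : ℕ} (α : DForm E M p) : Prop :=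
  ∀ x₀ : M, ContDiffOn ℝ ((⊤ : ℕ∞) : WithTop ℕ∞) (α.coord x₀) (extChartAt 𝓘(ℝ, E) x₀).target

/-- The exterior derivative, computed in a chart around each point. -/
def DForm.d {p : ℕ} (α : DForm E M p) : DForm E M (p + 1) := fun x =>
  ofCoordAt x (extDeriv (α.coord x) (extChartAt 𝓘(ℝ, E) x x))

/-- The interior product `ι_v α = α(v, ·, …, ·)`. -/
def DForm.ι {p : ℕ} (v : VField E M) (α : DForm E M (p + 1)) : DForm E M p := fun x =>
  contractVec (v x) (α x)

/-- The Lie derivative of a form along a vector field, computed in a chart around each point by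
`(L_v α)(w₁, …, w_p) = (D_v α)(w₁, …, w_p) + ∑ i, α(w₁, …, D_{wᵢ} v, …, w_p)`,
which is `v(α(W₁, …, W_p)) - ∑ i, α(W₁, …, [v, Wᵢ], …, W_p)` for the vector fields `Wᵢ` that are
constant in the chart. -/
def DForm.lie {p : ℕ} (v : VField E M) (α : DForm E M p) : DForm E M p := fun x =>
  ofCoordAt x
    (fderiv ℝ (α.coord x) (extChartAt 𝓘(ℝ, E) x x) (v.coord x (extChartAt 𝓘(ℝ, E) x x)) +
      derivAct (fderiv ℝ (v.coord x) (extChartAt 𝓘(ℝ, E) x x))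
        (α.coord x (extChartAt 𝓘(ℝ, E) x x)))

/-! ### Forms of mixed degree -/

/-- The form of mixed degree whose only component is `α`, in degree `p`. -/
def DForm.homog {p : ℕ} (α : DForm E M p) : GForm E M := Pi.single p α

/-- A form of mixed degree is smooth if its components are. -/
def GForm.IsSmooth (α : GForm E M) : Prop := ∀ p, (α p).IsSmooth

/-- The exterior derivative on forms of mixed degree. -/
def GForm.d (α : GForm E M) : GForm E M
  | 0 => 0
  | p + 1 => (α p).d

/-- The interior product on forms of mixed degree. -/
def GForm.ι (v : VField E M) (α : GForm E M) : GForm E M := fun p => (α (p + 1)).ι v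

/-- The Lie derivative on forms of mixed degree. -/
def GForm.lie (v : VField E M) (α : GForm E M) : GForm E M := fun p => (α p).lie v

/-- The iterated contraction `ι(v₁ ∧ … ∧ v_k) = ι_{v_k} ⋯ ι_{v₁}`. -/
def GForm.contract : (k : ℕ) → (Fin k → VField E M) → GForm E M → GForm E M
  | 0, _, α => α
  | k + 1, v, α => GForm.contract k (Fin.tail v) (α.ι (v 0))

/-! ### Algebra of contractions -/

theorem GForm.ι_comm (v w : VField E M) (α : GForm E M) :
    (α.ι v).ι w = -((α.ι w).ι v) := by
  funext p x
  ext u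
  change α (p + 2) x (Fin.cons (v x) (Fin.cons (w x) u))
    = -(α (p + 2) x (Fin.cons (w x) (Fin.cons (v x) u)))
  have h := (α (p + 2) x).toAlternatingMap.map_swap
    (Fin.cons (w x) (Fin.cons (v x) u)) (i := 0) (j := 1) (by simp)
  simp only [ContinuousAlternatingMap.coe_toAlternatingMap] at h
  rw [← h]
  congr 1
  funext j
  refine Fin.cases ?_ (fun j => Fin.cases ?_ (fun j => ?_) j) j
  · simp [Function.comp]
  · simp [Function.comp]
  · rw [Function.comp, Equiv.swap_apply_of_ne_of_ne]
    · rfl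
    · simp
    · simp [Fin.ext_iff]

theorem GForm.ι_neg (v : VField E M) (α : GForm E M) : (-α).ι v = -(α.ι v) := rfl

theorem GForm.ι_zero (v : VField E M) : (0 : GForm E M).ι v = 0 := rfl

theorem GForm.contract_neg (k : ℕ) (v : Fin k → VField E M) (α : GForm E M) :
    GForm.contract k v (-α) = -GForm.contract k v α := by
  induction k generalizing α with
  | zero => rfl
  | succ k ih => simp only [GForm.contract, GForm.ι_neg, ih]

theorem GForm.contract_zero (k : ℕ) (v : Fin k → VField E M) :
    GForm.contract k v (0 : GForm E M) = 0 := by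
  induction k with
  | zero => rfl
  | succ k ih => simp only [GForm.contract, GForm.ι_zero, ih]

theorem GForm.contract_ι (k : ℕ) (v : Fin k → VField E M) (w : VField E M) (α : GForm E M) :
    GForm.contract k v (α.ι w) = (-1 : ℝ) ^ k • (GForm.contract k v α).ι w := by
  induction k generalizing α with
  | zero => simp [GForm.contract]
  | succ k ih =>
    simp only [GForm.contract]
    rw [GForm.ι_comm, GForm.contract_neg, ih, pow_succ, mul_neg_one]
    exact (neg_smul _ _).symm

theorem GForm.contract_congr (k : ℕ) (v v' : Fin k → VField E M) (α : GForm E M)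
    (h : ∀ j, α.ι (v j) = α.ι (v' j)) : GForm.contract k v α = GForm.contract k v' α := by
  induction k generalizing α with
  | zero => rfl
  | succ k ih =>
    simp only [GForm.contract]
    rw [h 0, GForm.contract_ι, GForm.contract_ι, ih (Fin.tail v) (Fin.tail v') α
      fun j => h j.succ]

theorem GForm.contract_eq_zero (k : ℕ) (v : Fin k → VField E M) (α : GForm E M) (j : Fin k)
    (h : α.ι (v j) = 0) : GForm.contract k v α = 0 := by
  induction k generalizing α with
  | zero => exact j.elim0
  | succ k ih =>
    simp only [GForm.contract]
    revert h
    refine Fin.cases (fun h => ?_) (fun i h => ?_) j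
    · rw [h, GForm.contract_zero]
    · refine ih (Fin.tail v) (α.ι (v 0)) i ?_
      rw [GForm.ι_comm]
      change -((α.ι (v i.succ)).ι (v 0)) = 0
      rw [h, GForm.ι_zero, neg_zero]

/-! ### Conserved quantities -/

/-- Locally conserved quantities: smooth forms whose Lie derivative along `v` is closed. -/
def locConserved (v : VField E M) : Set (GForm E M) :=
  {α | α.IsSmooth ∧ (α.lie v).d = 0}

/-- Globally conserved quantities: smooth forms whose Lie derivative along `v` is exact. -/
def globConserved (v : VField E M) : Set (GForm E M) :=
  {α | α.IsSmooth ∧ ∃ γ : GForm E M, γ.IsSmooth ∧ α.lie v = γ.d}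

/-- Strictly conserved quantities: smooth forms whose Lie derivative along `v` vanishes. -/
def strictConserved (v : VField E M) : Set (GForm E M) :=
  {α | α.IsSmooth ∧ α.lie v = 0}

/-! ### Pre-`n`-plectic forms and the Lie `n`-algebra of observables -/

variable [IsManifold 𝓘(ℝ, E) ((⊤ : ℕ∞) : WithTop ℕ∞) M]

/-- A pre-`n`-plectic form: a smooth closed form of degree `n + 1`. -/
def IsPrePlectic {n : ℕ} (ω : DForm E M (n + 1)) : Prop := ω.IsSmooth ∧ ω.d = 0

/-- `v` is a Hamiltonian vector field for the form `α` of degree `n - 1`, i.e. a smooth vector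
field with `dα = -ι_v ω`. -/
def IsHamiltonianField {n : ℕ} (ω : DForm E M (n + 1)) (α : DForm E M (n - 1))
    (v : VField E M) : Prop :=
  v.IsSmooth ∧ α.homog.d = -(ω.homog.ι v)

/-- Hamiltonian forms: smooth `(n - 1)`-forms that admit a Hamiltonian vector field. -/
def IsHamiltonian {n : ℕ} (ω : DForm E M (n + 1)) (α : DForm E M (n - 1)) : Prop :=
  α.IsSmooth ∧ ∃ v : VField E M, IsHamiltonianField ω α v

/-- The graded vector space underlying the Lie `n`-algebra of observables. Its part of degree `i`,
`0 ≤ i ≤ n - 1`, is given by the components in form degree `n - 1 - i`: these are arbitrary smooth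
forms for `i > 0` and Hamiltonian forms for `i = 0`. -/
def observables {n : ℕ} (ω : DForm E M (n + 1)) : Set (GForm E M) :=
  {α | α.IsSmooth ∧ (∀ p, n ≤ p → α p = 0) ∧ IsHamiltonian ω (α (n - 1))}

open Classical in
/-- A choice of a Hamiltonian vector field for a Hamiltonian form `α`. -/
def hamField {n : ℕ} (ω : DForm E M (n + 1)) (α : DForm E M (n - 1)) : VField E M :=
  if h : ∃ v : VField E M, IsHamiltonianField ω α v then h.choose else 0

/-- The sign `ς(k) = -(-1)^{k(k+1)/2}`. -/
def bracketSign (k : ℕ) : ℝ := -(-1) ^ (k * (k + 1) / 2)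

/-- The brackets `l_k`, `k ≥ 1`, of the Lie `n`-algebra of observables, extended multilinearly to
non-homogeneous observables. The bracket `l₁` is the exterior derivative on the part of positive
degree (form degree `< n - 1`) and vanishes on the part of degree `0` (form degree `n - 1`). For
`k ≥ 2` the bracket depends only on the parts `α_j` of degree `0` of the arguments, and is
`ς(k) ι(v_{α₁} ∧ … ∧ v_{α_k}) ω`. By convention `l₀ = 0`. -/
def bracket {n : ℕ} (ω : DForm E M (n + 1)) : (k : ℕ) → (Fin k → GForm E M) → GForm E M
  | 0, _ => 0
  | 1, β => fun p => if p < n then (β 0).d p else 0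
  | k + 2, β => bracketSign (k + 2) •
      GForm.contract (k + 2) (fun j => hamField ω (β j (n - 1))) ω.homog

/-- An `L_∞`-subalgebra of the Lie `n`-algebra of observables: a graded linear subspace that is
closed under all brackets. -/
structure IsLInftySubalgebra {n : ℕ} (ω : DForm E M (n + 1)) (S : Set (GForm E M)) : Prop where
  subset : S ⊆ observables ω
  zero_mem : (0 : GForm E M) ∈ S
  add_mem : ∀ α ∈ S, ∀ β ∈ S, α + β ∈ S
  smul_mem : ∀ c : ℝ, ∀ α ∈ S, c • α ∈ S
  component_mem : ∀ α ∈ S, ∀ p : ℕ, (α p).homog ∈ S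
  bracket_mem : ∀ k : ℕ, 1 ≤ k → ∀ β : Fin k → GForm E M, (∀ j, β j ∈ S) → bracket ω k β ∈ S

/-! ### The brackets do not depend on the choice of Hamiltonian vector fields -/

/-- For `k ≥ 2` the bracket may be computed with any Hamiltonian vector fields. -/
theorem bracket_eq {n : ℕ} (ω : DForm E M (n + 1)) (k : ℕ) (β : Fin (k + 2) → GForm E M)
    (v : Fin (k + 2) → VField E M) (hv : ∀ j, IsHamiltonianField ω (β j (n - 1)) (v j)) :
    bracket ω (k + 2) β = bracketSign (k + 2) • GForm.contract (k + 2) v ω.homog := by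
  simp only [bracket]
  congr 1
  refine GForm.contract_congr _ _ _ _ fun j => ?_
  have hex : ∃ w : VField E M, IsHamiltonianField ω (β j (n - 1)) w := ⟨v j, hv j⟩
  have h1 : IsHamiltonianField ω (β j (n - 1)) (hamField ω (β j (n - 1))) := by
    rw [hamField, dif_pos hex]
    exact hex.choose_spec
  exact neg_injective (h1.2.symm.trans (hv j).2)

/-- For `k ≥ 2` the bracket vanishes if one of its arguments is an observable whose part of
degree `0` is zero, in particular if one of them is homogeneous of positive degree. -/
theorem bracket_eq_zero {n : ℕ} (ω : DForm E M (n + 1)) (k : ℕ) (β : Fin (k + 2) → GForm E M)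
    (hβ : ∀ j, β j ∈ observables ω) (j : Fin (k + 2)) (hj : β j (n - 1) = 0) :
    bracket ω (k + 2) β = 0 := by
  simp only [bracket]
  rw [GForm.contract_eq_zero _ _ _ j, smul_zero]
  have hex := (hβ j).2.2.2
  have h1 : IsHamiltonianField ω (β j (n - 1)) (hamField ω (β j (n - 1))) := by
    rw [hamField, dif_pos hex]
    exact hex.choose_spec
  have h2 := h1.2
  rw [hj] at h2 ⊢
  have h0 : (DForm.homog (0 : DForm E M (n - 1))).d = 0 := by
    have hz : DForm.homog (0 : DForm E M (n - 1)) = 0 := Pi.single_zero _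
    rw [hz]
    funext p
    cases p with
    | zero => rfl
    | succ p =>
      funext x
      have hc : DForm.coord (0 : DForm E M p) x = 0 := rfl
      change ofCoordAt x (extDeriv (DForm.coord (0 : DForm E M p) x) _) = 0
      rw [hc]
      have hd : extDeriv (0 : E → E [⋀^Fin p]→L[ℝ] ℝ) (extChartAt 𝓘(ℝ, E) x x) = 0 := by
        have h := extDeriv_smul (x := extChartAt 𝓘(ℝ, E) x x) (0 : ℝ)
          (0 : E → E [⋀^Fin p]→L[ℝ] ℝ)
        simpa using h
      rw [hd]
      rfl
  rw [h0] at h2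
  exact neg_eq_zero.1 h2.symm

end Manifold

end Multisymplectic

end

noncomputable section

namespace Multisymplectic

/-! ### Contraction and derivation on one vector space -/

section Linear

variable {V : Type*} [AddCommGroup V] [Module ℝ V] [TopologicalSpace V]

/-! Brackets of locally conserved observables turn out to be strictly conserved. For `l₁` this is
`L_v dβ = d L_v β = 0`. For `k ≥ 2`, let `w_j` be a Hamiltonian field of the degree-`0` part of
`β_j`. Since `[L_v, ι_w] = ι_{[v,w]}` and `L_v ω = 0`, it is enough that each `ι_{[v,w_j]} ω`
vanishes. The same commutator gives `ι_{[v,w_j]} ω = L_v ι_{w_j} ω = -L_v dβ_j = -d L_v β_j = 0`.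
This is `lie_bracket_eq_zero`.

As strict conservation implies global, and global implies local, this one vanishing closes all three
spaces under the brackets (`isLInftySubalgebra_inter`). It remains that brackets of observables are
observables (`bracket_mem_observables`). Only `l₁` and `l₂` can reach the degree where the
Hamiltonian condition is imposed: values of `l₁` there are closed, and `[v_α, v_β]` is a Hamiltonian
field for `l₂(α, β)` (`d_contract_two`).

The Cartan calculus behind this is proved on a normed space and carried over pointwise, each point
using its own chart. Iterating `d` also requires that `d` be computable in a chart centred elsewhere
(`DForm.coord_d`), by naturality under changes of charts. -/

theorem contractVec_compContinuousLinearMap {W : Type*} [AddCommGroup W] [Module ℝ W]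
    [TopologicalSpace W] {p : ℕ} (a : W) (A : W →L[ℝ] V) (f : V [⋀^Fin (p + 1)]→L[ℝ] ℝ) :
    contractVec a (f.compContinuousLinearMap A) =
      (contractVec (A a) f).compContinuousLinearMap A := by
  ext w
  simp only [contractVec_apply, ContinuousAlternatingMap.compContinuousLinearMap_apply]
  congr 1
  funext j
  refine Fin.cases ?_ (fun j => ?_) j <;> simp

/-- Contraction with `a` and the derivation action of `A` commute up to contraction with `A a`. -/
theorem derivAct_contractVec {p : ℕ} (A : V →L[ℝ] V) (a : V) (f : V [⋀^Fin (p + 1)]→L[ℝ] ℝ) :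
    derivAct A (contractVec a f) = contractVec a (derivAct A f) - contractVec (A a) f := by
  ext w
  simp only [derivAct_apply, contractVec_apply, ContinuousAlternatingMap.sub_apply,
    Fin.sum_univ_succ, Fin.cons_zero, Fin.update_cons_zero, Fin.cons_succ, Fin.cons_update]
  ring

/-- Moving slot `i` to the front passes `i` entries. This is the sign in the alternating sum for
`extDeriv`, so the two can be compared term by term. -/
theorem map_cons_removeNth {p : ℕ} (f : V [⋀^Fin (p + 1)]→L[ℝ] ℝ) (w : Fin (p + 1) → V)
    (i : Fin (p + 1)) (a : V) :
    f (Function.update w i a) = (-1) ^ (i : ℕ) * f (Fin.cons a (i.removeNth w)) := by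
  have h := f.toAlternatingMap.map_insertNth i a (i.removeNth w)
  simpa [Fin.insertNth_removeNth, Matrix.vecCons] using h

end Linear

/-! ### Cartan calculus on a normed space -/

section Calculus

variable {E : Type*} [NormedAddCommGroup E] [NormedSpace ℝ E]

theorem contractVec_eq_curryLeft {p : ℕ} (a : E) (f : E [⋀^Fin (p + 1)]→L[ℝ] ℝ) :
    contractVec a f = f.curryLeft a := rfl

/-- Contraction as a continuous bilinear map. -/
def contractCLM (E : Type*) [NormedAddCommGroup E] [NormedSpace ℝ E] (p : ℕ) :
    (E [⋀^Fin (p + 1)]→L[ℝ] ℝ) →L[ℝ] E →L[ℝ] E [⋀^Fin p]→L[ℝ] ℝ :=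
  ContinuousAlternatingMap.curryLeftLI.toContinuousLinearMap

theorem contDiffOn_contractVec {p : ℕ} {k : WithTop ℕ∞} {v : E → E}
    {f : E → E [⋀^Fin (p + 1)]→L[ℝ] ℝ} {s : Set E}
    (hv : ContDiffOn ℝ k v s) (hf : ContDiffOn ℝ k f s) :
    ContDiffOn ℝ k (fun y => contractVec (v y) (f y)) s :=
  have hC : ContDiff ℝ k (contractCLM E p) := ContinuousLinearMap.contDiff _
  (hC.comp_contDiffOn hf).clm_apply hv

theorem fderiv_contractVec {p : ℕ} {v : E → E} {f : E → E [⋀^Fin (p + 1)]→L[ℝ] ℝ} {y : E}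
    (hv : DifferentiableAt ℝ v y) (hf : DifferentiableAt ℝ f y) (h : E) :
    fderiv ℝ (fun z => contractVec (v z) (f z)) y h =
      contractVec (v y) (fderiv ℝ f y h) + contractVec (fderiv ℝ v y h) (f y) := by
  have hB := (contractCLM E p).hasFDerivAt_of_bilinear hf.hasFDerivAt hv.hasFDerivAt
  rw [add_comm]
  exact congrArg (fun D => D h) hB.fderiv

/-- The Lie derivative along `v` of a form on a vector space. -/
def lieDeriv {p : ℕ} (v : E → E) (f : E → E [⋀^Fin p]→L[ℝ] ℝ) (y : E) : E [⋀^Fin p]→L[ℝ] ℝ :=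
  fderiv ℝ f y (v y) + derivAct (fderiv ℝ v y) (f y)

/-- Cartan's formula in degree `0`: there is no `d ι_v` term, and the derivation action is an empty
sum. -/
theorem lieDeriv_of_isEmpty {f : E → E [⋀^Fin 0]→L[ℝ] ℝ} {v : E → E} {y : E} :
    lieDeriv v f y = contractVec (v y) (extDeriv f y) := by
  ext w
  simp [lieDeriv, derivAct_apply, contractVec_apply, extDeriv,
    ContinuousAlternatingMap.alternatizeUncurryFin_apply, Subsingleton.elim _ w]

/-- Cartan's formula. The leading term of `ι_v df` is `D_v f`. Its other terms cancel the part of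
`d(ι_v f)` where `f` is differentiated; what remains differentiates `v` and is the derivation
action. -/
theorem lieDeriv_eq_extDeriv_add {p : ℕ} {f : E → E [⋀^Fin (p + 1)]→L[ℝ] ℝ} {v : E → E} {y : E}
    (hv : DifferentiableAt ℝ v y) (hf : DifferentiableAt ℝ f y) :
    lieDeriv v f y = extDeriv (fun z => contractVec (v z) (f z)) y +
      contractVec (v y) (extDeriv f y) := by
  ext w
  have hr : ∀ i : Fin (p + 1), i.succ.removeNth (Fin.cons (v y) w : Fin (p + 2) → E) =
      Fin.cons (v y) (i.removeNth w) := fun i => by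
    funext j
    refine Fin.cases ?_ (fun j => ?_) j <;> simp [Fin.removeNth]
  simp only [lieDeriv, extDeriv, ContinuousAlternatingMap.add_apply, derivAct_apply,
    contractVec_apply, ContinuousAlternatingMap.alternatizeUncurryFin_apply,
    fderiv_contractVec hv hf, Fin.sum_univ_succ (n := p + 1), map_cons_removeNth, hr,
    Fin.cons_succ, Fin.cons_zero, Fin.val_succ, Fin.val_zero, pow_zero,
    zsmul_eq_mul, smul_add, Finset.sum_add_distrib, pow_succ, Fin.removeNth_zero, Fin.tail_cons]
  simp
  ring

/-- The product rule contributes `Dw(v)` and `derivAct_contractVec` contributes `-Dv(w)`; together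
they are the bracket. -/
theorem lieDeriv_contractVec {p : ℕ} {f : E → E [⋀^Fin (p + 1)]→L[ℝ] ℝ} {v w : E → E} {y : E}
    (hw : DifferentiableAt ℝ w y) (hf : DifferentiableAt ℝ f y) :
    lieDeriv v (fun z => contractVec (w z) (f z)) y =
      contractVec (VectorField.lieBracket ℝ v w y) (f y) + contractVec (w y) (lieDeriv v f y) := by
  simp only [lieDeriv, fderiv_contractVec hw hf, derivAct_contractVec, VectorField.lieBracket]
  simp only [contractVec_eq_curryLeft, map_sub, ContinuousAlternatingMap.curryLeft_add,
    add_apply]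
  abel

theorem derivAct_add {p : ℕ} (A : E →L[ℝ] E) (f g : E [⋀^Fin p]→L[ℝ] ℝ) :
    derivAct A (f + g) = derivAct A f + derivAct A g := by
  ext w
  simp [derivAct_apply, Finset.sum_add_distrib]

theorem derivAct_smul {p : ℕ} (A : E →L[ℝ] E) (c : ℝ) (f : E [⋀^Fin p]→L[ℝ] ℝ) :
    derivAct A (c • f) = c • derivAct A f := by
  ext w
  simp [derivAct_apply, Finset.mul_sum]

theorem lieDeriv_add {p : ℕ} {v : E → E} {f g : E → E [⋀^Fin p]→L[ℝ] ℝ} {y : E}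
    (hf : DifferentiableAt ℝ f y) (hg : DifferentiableAt ℝ g y) :
    lieDeriv v (f + g) y = lieDeriv v f y + lieDeriv v g y := by
  simp only [lieDeriv, fderiv_add hf hg, Pi.add_apply, derivAct_add, add_apply]
  abel

theorem lieDeriv_smul {p : ℕ} (v : E → E) (c : ℝ) (f : E → E [⋀^Fin p]→L[ℝ] ℝ) (y : E) :
    lieDeriv v (c • f) y = c • lieDeriv v f y := by
  have h : fderiv ℝ (c • f) y = c • fderiv ℝ f y := 
    congrFun (fderiv_const_smul_field (𝕜 := ℝ) (f := f) c) y
  simp only [lieDeriv, Pi.smul_apply, derivAct_smul, smul_add, h]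
  rfl

end Calculus

theorem minSmoothness_two_le_top : minSmoothness ℝ 2 ≤ ((⊤ : ℕ∞) : WithTop ℕ∞) := by
  rw [minSmoothness_of_isRCLikeNormedField]
  exact WithTop.coe_le_coe.2 (le_top : (2 : ℕ∞) ≤ ⊤)

/-! ### Transfer to the manifold through charts -/

section Charts

variable {E : Type*} [NormedAddCommGroup E] [NormedSpace ℝ E]
  {M : Type*} [TopologicalSpace M] [ChartedSpace E M]

/-- The derivative at `z` of the chart around `x`, as an endomorphism of the model space. -/
def chartDeriv (x z : M) : E →L[ℝ] E :=
  mfderiv 𝓘(ℝ, E) 𝓘(ℝ, E) (extChartAt 𝓘(ℝ, E) x) z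

/-- The derivative at `y` of the inverse of the chart around `x`, as an endomorphism of the model
space. -/
def chartSymmDeriv (x : M) (y : E) : E →L[ℝ] E :=
  mfderiv 𝓘(ℝ, E) 𝓘(ℝ, E) (extChartAt 𝓘(ℝ, E) x).symm y

theorem DForm.coord_apply {p : ℕ} (α : DForm E M p) (x : M) (y : E) (w : Fin p → E) :
    α.coord x y w = (α ((extChartAt 𝓘(ℝ, E) x).symm y) : E [⋀^Fin p]→L[ℝ] ℝ)
      (fun i => chartSymmDeriv x y (w i)) := rfl

theorem VField.coord_apply (v : VField E M) (x : M) (y : E) :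
    v.coord x y = chartDeriv (E := E) x ((extChartAt 𝓘(ℝ, E) x).symm y)
      (v ((extChartAt 𝓘(ℝ, E) x).symm y)) := rfl

theorem DForm.lie_apply {p : ℕ} (v : VField E M) (α : DForm E M p) (x : M) :
    α.lie v x = ofCoordAt x
      (lieDeriv (v.coord x) (α.coord x) (extChartAt 𝓘(ℝ, E) x x)) := rfl

theorem ofCoordAt_add {p : ℕ} (x : M) (f g : E [⋀^Fin p]→L[ℝ] ℝ) :
    ofCoordAt x (f + g) = ofCoordAt x f + ofCoordAt x g := rfl

theorem ofCoordAt_contractVec_coord {p : ℕ} (v : VField E M) (x : M)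
    (f : E [⋀^Fin (p + 1)]→L[ℝ] ℝ) :
    ofCoordAt x (contractVec (v.coord x (extChartAt 𝓘(ℝ, E) x x)) f) =
      contractVec (v x) (ofCoordAt x f) := by
  have h : v.coord x (extChartAt 𝓘(ℝ, E) x x) = chartDeriv (E := E) x x (v x) := by
    -- Every tangent space is definitionally `E`; with a non-dependent type, the base point can be
    -- rewritten.
    let v' : M → E := v
    change chartDeriv x _ (v' _) = chartDeriv x x (v' x)
    rw [extChartAt_to_inv]
  rw [h]
  exact (contractVec_compContinuousLinearMap (V := E) (W := E) _ (chartDeriv x x) f).symm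

theorem DForm.IsSmooth.contDiffAt {p : ℕ} {α : DForm E M p} (hα : α.IsSmooth) {x : M} {y : E}
    (hy : y ∈ (extChartAt 𝓘(ℝ, E) x).target) :
    ContDiffAt ℝ ((⊤ : ℕ∞) : WithTop ℕ∞) (α.coord x) y :=
  (hα x).contDiffAt (extChartAt_target_mem_nhds' hy)

theorem DForm.IsSmooth.differentiableAt {p : ℕ} {α : DForm E M p} (hα : α.IsSmooth) {x : M}
    {y : E} (hy : y ∈ (extChartAt 𝓘(ℝ, E) x).target) : DifferentiableAt ℝ (α.coord x) y :=
  (hα.contDiffAt hy).differentiableAt (by simp)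

theorem DForm.lie_zero_form {α : DForm E M 0} (v : VField E M) : α.lie v = α.d.ι v := by
  funext x
  rw [DForm.lie_apply, lieDeriv_of_isEmpty, ofCoordAt_contractVec_coord]
  rfl

variable [IsManifold 𝓘(ℝ, E) ((⊤ : ℕ∞) : WithTop ℕ∞) M]

theorem chartSymmDeriv_chartDeriv_symm {x : M} {y : E}
    (hy : y ∈ (extChartAt 𝓘(ℝ, E) x).target) (u : E) :
    chartSymmDeriv x y (chartDeriv x ((extChartAt 𝓘(ℝ, E) x).symm y) u) = u := by
  have : IsManifold 𝓘(ℝ, E) 1 M := .of_le (n := ((⊤ : ℕ∞) : WithTop ℕ∞)) (by norm_cast)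
  have h := mfderivWithin_extChartAt_symm_comp_mfderiv_extChartAt hy
  simp only [modelWithCornersSelf_coe, Set.range_id, mfderivWithin_univ] at h
  exact congrArg (fun A : E →L[ℝ] E => A u) h

theorem chartSymmDeriv_chartDeriv {x z : M} (hz : z ∈ (extChartAt 𝓘(ℝ, E) x).source) (u : E) :
    chartSymmDeriv x (extChartAt 𝓘(ℝ, E) x z) (chartDeriv x z u) = u := by
  have h := chartSymmDeriv_chartDeriv_symm (PartialEquiv.map_source _ hz) u
  rwa [PartialEquiv.left_inv _ hz] at h

theorem DForm.coord_extChartAt {p : ℕ} (α : DForm E M p) {x z : M}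
    (hz : z ∈ (extChartAt 𝓘(ℝ, E) x).source) (w : Fin p → E) :
    α.coord x (extChartAt 𝓘(ℝ, E) x z) (fun i => chartDeriv x z (w i)) =
      (α z : E [⋀^Fin p]→L[ℝ] ℝ) w := by
  rw [DForm.coord_apply]
  simp only [chartSymmDeriv_chartDeriv hz]
  let a : M → E [⋀^Fin p]→L[ℝ] ℝ := α
  change a _ w = a z w
  rw [PartialEquiv.left_inv _ hz]

theorem ofCoordAt_coord {p : ℕ} (α : DForm E M p) (x : M) :
    ofCoordAt x (α.coord x (extChartAt 𝓘(ℝ, E) x x)) = α x :=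
  ContinuousAlternatingMap.ext fun w => α.coord_extChartAt (mem_extChartAt_source x) w

theorem DForm.coord_ι {p : ℕ} (v : VField E M) (α : DForm E M (p + 1)) {x : M} {y : E}
    (hy : y ∈ (extChartAt 𝓘(ℝ, E) x).target) :
    (α.ι v).coord x y = contractVec (v.coord x y) (α.coord x y) := by
  ext w
  rw [contractVec_apply, DForm.coord_apply, DForm.coord_apply, VField.coord_apply]
  let a : M → E [⋀^Fin (p + 1)]→L[ℝ] ℝ := α
  let v' : M → E := v
  change a _ (Fin.cons (v' _) _) = a _ _
  congr 1
  funext j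
  refine Fin.cases ?_ (fun j => ?_) j
  · exact (chartSymmDeriv_chartDeriv_symm hy _).symm
  · rfl

/-- The derivative of a change of charts. -/
theorem fderiv_extChartAt_comp_symm {x x' : M} {y : E} (hy : y ∈ (extChartAt 𝓘(ℝ, E) x).target)
    (hy' : (extChartAt 𝓘(ℝ, E) x).symm y ∈ (extChartAt 𝓘(ℝ, E) x').source) :
    fderiv ℝ (extChartAt 𝓘(ℝ, E) x' ∘ (extChartAt 𝓘(ℝ, E) x).symm) y =
      (chartDeriv x' ((extChartAt 𝓘(ℝ, E) x).symm y)).comp (chartSymmDeriv x y) := by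
  have : IsManifold 𝓘(ℝ, E) 1 M := .of_le (n := ((⊤ : ℕ∞) : WithTop ℕ∞)) (by norm_cast)
  have h1 : MDifferentiableAt 𝓘(ℝ, E) 𝓘(ℝ, E) (extChartAt 𝓘(ℝ, E) x).symm y := by
    simpa [mdifferentiableWithinAt_univ] using mdifferentiableWithinAt_extChartAt_symm hy
  have h2 := mdifferentiableAt_extChartAt (I := 𝓘(ℝ, E)) (x := x')
    (y := (extChartAt 𝓘(ℝ, E) x).symm y) (by simpa using hy')
  rw [← mfderiv_eq_fderiv]
  exact mfderiv_comp y h2 h1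

theorem contDiffAt_extChartAt_comp_symm {x x' : M} {y : E}
    (hy : y ∈ (extChartAt 𝓘(ℝ, E) x).target)
    (hy' : (extChartAt 𝓘(ℝ, E) x).symm y ∈ (extChartAt 𝓘(ℝ, E) x').source) :
    ContDiffAt ℝ ((⊤ : ℕ∞) : WithTop ℕ∞)
      (extChartAt 𝓘(ℝ, E) x' ∘ (extChartAt 𝓘(ℝ, E) x).symm) y := by
  rw [← contMDiffAt_iff_contDiffAt]
  refine ContMDiffAt.comp y (contMDiffAt_extChartAt' (by simpa using hy')) ?_
  exact (contMDiffOn_extChartAt_symm x).contMDiffAt (extChartAt_target_mem_nhds' hy)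

/-- The exterior derivative can be computed in any chart. -/
theorem DForm.coord_d {p : ℕ} {α : DForm E M p} (hα : α.IsSmooth) {x : M} {y : E}
    (hy : y ∈ (extChartAt 𝓘(ℝ, E) x).target) :
    α.d.coord x y = extDeriv (α.coord x) y := by
  set z := (extChartAt 𝓘(ℝ, E) x).symm y with hz
  have hz' : (extChartAt 𝓘(ℝ, E) x).symm y ∈ (extChartAt 𝓘(ℝ, E) z).source :=
    mem_extChartAt_source z
  -- The chart around `z` is the one that defines `α.d` at `z`. Near `y`, `α.coord x` is the
  -- pullback of `α.coord z` by the change of charts, and `extDeriv` commutes with pullback.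
  have hev : α.coord x =ᶠ[𝓝 y] fun y' =>
      (α.coord z ((extChartAt 𝓘(ℝ, E) z ∘ (extChartAt 𝓘(ℝ, E) x).symm) y')).compContinuousLinearMap
        (fderiv ℝ (extChartAt 𝓘(ℝ, E) z ∘ (extChartAt 𝓘(ℝ, E) x).symm) y') := by
    have hc : ContinuousAt (extChartAt 𝓘(ℝ, E) x).symm y :=
      continuousAt_extChartAt_symm'' hy
    filter_upwards [extChartAt_target_mem_nhds' hy,
      hc.preimage_mem_nhds (extChartAt_source_mem_nhds (I := 𝓘(ℝ, E)) z)] with y' h1 h2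
    rw [fderiv_extChartAt_comp_symm h1 h2]
    ext w
    exact (α.coord_extChartAt h2 _).symm
  rw [hev.extDeriv_eq, extDeriv_pullback (r := ((⊤ : ℕ∞) : WithTop ℕ∞))
    (f := extChartAt 𝓘(ℝ, E) z ∘ (extChartAt 𝓘(ℝ, E) x).symm)
    (hα.differentiableAt (PartialEquiv.map_source _ hz'))
    (contDiffAt_extChartAt_comp_symm hy hz') minSmoothness_two_le_top,
    fderiv_extChartAt_comp_symm hy hz']
  rfl

theorem DForm.IsSmooth.d {p : ℕ} {α : DForm E M p} (hα : α.IsSmooth) : α.d.IsSmooth := by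
  intro x
  have h : ContDiffOn ℝ ((⊤ : ℕ∞) : WithTop ℕ∞) (extDeriv (α.coord x))
      (extChartAt 𝓘(ℝ, E) x).target := by
    have h1 := (hα x).fderiv_of_isOpen (m := ((⊤ : ℕ∞) : WithTop ℕ∞))
      (isOpen_extChartAt_target x) (by norm_cast)
    exact (ContinuousAlternatingMap.alternatizeUncurryFinCLM ℝ E ℝ).contDiff.comp_contDiffOn h1
  exact h.congr fun y hy => DForm.coord_d hα hy

theorem DForm.d_d {p : ℕ} {α : DForm E M p} (hα : α.IsSmooth) : α.d.d = 0 := by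
  funext x
  have hev : α.d.coord x =ᶠ[𝓝 (extChartAt 𝓘(ℝ, E) x x)] extDeriv (α.coord x) := by
    filter_upwards [extChartAt_target_mem_nhds x] with y hy using DForm.coord_d hα hy
  change ofCoordAt x (extDeriv (α.d.coord x) _) = 0
  rw [hev.extDeriv_eq, extDeriv_extDeriv_apply (hα.contDiffAt (mem_extChartAt_target x))
    minSmoothness_two_le_top]
  rfl

/-- The derivative of the chart is the tangent bundle trivialization on fibres, so `v.coord x` is
the fibre component of a smooth section, composed with the inverse chart. -/
theorem VField.IsSmooth.coord {v : VField E M} (hv : v.IsSmooth) (x : M) :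
    ContDiffOn ℝ ((⊤ : ℕ∞) : WithTop ℕ∞) (v.coord x) (extChartAt 𝓘(ℝ, E) x).target := by
  have : IsManifold 𝓘(ℝ, E) 1 M := .of_le (n := ((⊤ : ℕ∞) : WithTop ℕ∞)) (by norm_cast)
  have h := (Bundle.Trivialization.contMDiffOn_section_baseSet_iff (IB := 𝓘(ℝ, E))
    (n := ((⊤ : ℕ∞) : WithTop ℕ∞)) (s := v)
    (trivializationAt E (TangentSpace 𝓘(ℝ, E)) x)).1 hv.contMDiffOn
  rw [← contMDiffOn_iff_contDiffOn]
  refine (h.comp (contMDiffOn_extChartAt_symm x) fun y hy => ?_).congr fun y hy => ?_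
  · simpa using PartialEquiv.map_target _ hy
  · have hs : (extChartAt 𝓘(ℝ, E) x).symm y ∈ (chartAt E x).source := by
      simpa using PartialEquiv.map_target _ hy
    change _ = (trivializationAt E (TangentSpace 𝓘(ℝ, E)) x ⟨_, v _⟩).2
    have hb : (extChartAt 𝓘(ℝ, E) x).symm y ∈
        (trivializationAt E (TangentSpace 𝓘(ℝ, E)) x).baseSet := by simpa using hs
    have h1 := TangentBundle.continuousLinearMapAt_trivializationAt (I := 𝓘(ℝ, E)) hs
    have h2 := congrFun (Bundle.Trivialization.coe_linearMapAt_of_mem (R := ℝ) _ hb)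
      (v ((extChartAt 𝓘(ℝ, E) x).symm y))
    exact (congrArg (fun A : E →L[ℝ] E => A (v ((extChartAt 𝓘(ℝ, E) x).symm y))) h1).symm.trans h2

theorem VField.IsSmooth.differentiableAt {v : VField E M} (hv : v.IsSmooth) {x : M} {y : E}
    (hy : y ∈ (extChartAt 𝓘(ℝ, E) x).target) : DifferentiableAt ℝ (v.coord x) y :=
  ((hv.coord x).contDiffAt (extChartAt_target_mem_nhds' hy)).differentiableAt (by simp)

theorem DForm.IsSmooth.ι {p : ℕ} {α : DForm E M (p + 1)} (hα : α.IsSmooth) {v : VField E M}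
    (hv : v.IsSmooth) : (α.ι v).IsSmooth := fun x =>
  (contDiffOn_contractVec (hv.coord x) (hα x)).congr fun _ hy => DForm.coord_ι v α hy

theorem coord_ι_eventuallyEq {p : ℕ} (v : VField E M) (α : DForm E M (p + 1)) (x : M) :
    (α.ι v).coord x =ᶠ[𝓝 (extChartAt 𝓘(ℝ, E) x x)]
      fun y => contractVec (v.coord x y) (α.coord x y) := by
  filter_upwards [extChartAt_target_mem_nhds x] with y hy using DForm.coord_ι v α hy

/-- Cartan's formula. -/
theorem DForm.lie_eq {p : ℕ} {α : DForm E M (p + 1)} (hα : α.IsSmooth) {v : VField E M}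
    (hv : v.IsSmooth) : α.lie v = (α.ι v).d + α.d.ι v := by
  funext x
  have hx := mem_extChartAt_target (I := 𝓘(ℝ, E)) x
  rw [DForm.lie_apply, lieDeriv_eq_extDeriv_add (hv.differentiableAt hx) (hα.differentiableAt hx),
    ← (coord_ι_eventuallyEq v α x).extDeriv_eq, ofCoordAt_add, ofCoordAt_contractVec_coord]
  rfl

/-- The chart expression of the Lie bracket at the centre of the chart. -/
theorem coord_mlieBracket (v w : VField E M) (x : M) :
    VField.coord (VectorField.mlieBracket 𝓘(ℝ, E) v w) x (extChartAt 𝓘(ℝ, E) x x) =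
      VectorField.lieBracket ℝ (v.coord x) (w.coord x) (extChartAt 𝓘(ℝ, E) x x) := by
  have : IsManifold 𝓘(ℝ, E) 1 M := .of_le (n := ((⊤ : ℕ∞) : WithTop ℕ∞)) (by norm_cast)
  -- `mlieBracket` is defined through these pullbacks. They invert the derivative of the inverse
  -- chart, which gives the derivative of the chart, as in `VField.coord`.
  let pb (u : VField E M) : E → E := VectorField.mpullbackWithin 𝓘(ℝ, E) 𝓘(ℝ, E)
    (extChartAt 𝓘(ℝ, E) x).symm u (Set.range 𝓘(ℝ, E))
  have hev : ∀ u : VField E M, pb u =ᶠ[𝓝 (extChartAt 𝓘(ℝ, E) x x)] u.coord x := by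
    intro u
    filter_upwards [extChartAt_target_mem_nhds x] with y hy
    have h1 := mfderiv_extChartAt_comp_mfderivWithin_extChartAt_symm hy
    have h2 := mfderivWithin_extChartAt_symm_comp_mfderiv_extChartAt hy
    change VectorField.mpullbackWithin _ _ _ _ _ _ = _
    rw [VectorField.mpullbackWithin_apply, ContinuousLinearMap.inverse_eq h2 h1]
    rfl
  have h : VectorField.mlieBracket 𝓘(ℝ, E) v w x =
      (chartDeriv x x).inverse (VectorField.lieBracket ℝ (v.coord x) (w.coord x)
        (extChartAt 𝓘(ℝ, E) x x)) := by
    have h2 : (extChartAt 𝓘(ℝ, E) x).symm ⁻¹' Set.univ ∩ Set.range 𝓘(ℝ, E) = Set.univ := by simp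
    rw [← (hev v).lieBracket_vectorField_eq (hev w), ← VectorField.lieBracketWithin_univ, ← h2]
    rfl
  have hinv : (chartDeriv x x : E →L[ℝ] E).IsInvertible :=
    isInvertible_mfderiv_extChartAt (mem_extChartAt_source x)
  let u : M → E := VectorField.mlieBracket 𝓘(ℝ, E) v w
  change chartDeriv x _ (u _) = _
  rw [extChartAt_to_inv]
  change chartDeriv (E := E) x x (VectorField.mlieBracket 𝓘(ℝ, E) v w x) = _
  rw [h]
  obtain ⟨A, hA⟩ := hinv
  rw [← hA, ContinuousLinearMap.inverse_equiv]
  simp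

/-- Contraction with the bracket is pointwise, so its coordinate expression is needed only at the
centre of the chart. -/
theorem DForm.lie_ι {p : ℕ} {α : DForm E M (p + 1)} (hα : α.IsSmooth) (v : VField E M)
    {w : VField E M} (hw : w.IsSmooth) :
    (α.ι w).lie v = α.ι (VectorField.mlieBracket 𝓘(ℝ, E) v w) + (α.lie v).ι w := by
  funext x
  have hx := mem_extChartAt_target (I := 𝓘(ℝ, E)) x
  have h : lieDeriv (v.coord x) ((α.ι w).coord x) (extChartAt 𝓘(ℝ, E) x x) =
      lieDeriv (v.coord x) (fun y => contractVec (w.coord x y) (α.coord x y))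
        (extChartAt 𝓘(ℝ, E) x x) := by
    rw [lieDeriv, (coord_ι_eventuallyEq w α x).fderiv_eq, (coord_ι_eventuallyEq w α x).self_of_nhds]
    rfl
  rw [DForm.lie_apply, h, lieDeriv_contractVec (hw.differentiableAt hx) (hα.differentiableAt hx), ofCoordAt_add, ← coord_mlieBracket, ofCoordAt_contractVec_coord,
    ofCoordAt_contractVec_coord, ofCoordAt_coord]
  rfl

theorem VField.IsSmooth.mlieBracket [CompleteSpace E] {v w : VField E M} (hv : v.IsSmooth)
    (hw : w.IsSmooth) : VField.IsSmooth (VectorField.mlieBracket 𝓘(ℝ, E) v w) := by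
  have : IsManifold 𝓘(ℝ, E) (minSmoothness ℝ 2) M :=
    .of_le minSmoothness_two_le_top
  have : IsManifold 𝓘(ℝ, E) (((⊤ : ℕ∞) : WithTop ℕ∞) + 1) M := by
    rw [show ((⊤ : ℕ∞) : WithTop ℕ∞) + 1 = ((⊤ : ℕ∞) : WithTop ℕ∞) from rfl]; infer_instance
  exact ContDiff.mlieBracket_vectorField (m := ⊤) (n := ⊤) hv hw (by simp)

end Charts

/-! ### Linearity, grading and Cartan calculus in mixed degree -/

section Forms

variable {E : Type*} [NormedAddCommGroup E] [NormedSpace ℝ E]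
  {M : Type*} [TopologicalSpace M] [ChartedSpace E M]

theorem DForm.IsSmooth.zero {p : ℕ} : (0 : DForm E M p).IsSmooth := fun _ =>
  (contDiffOn_const : ContDiffOn ℝ _ (fun _ : E => (0 : E [⋀^Fin p]→L[ℝ] ℝ)) _)

theorem DForm.IsSmooth.add {p : ℕ} {α β : DForm E M p} (hα : α.IsSmooth) (hβ : β.IsSmooth) :
    (α + β).IsSmooth := fun x => (hα x).add (hβ x)

theorem DForm.IsSmooth.smul {p : ℕ} (c : ℝ) {α : DForm E M p} (hα : α.IsSmooth) :
    (c • α).IsSmooth := fun x => (hα x).const_smul c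

theorem DForm.d_smul {p : ℕ} (c : ℝ) (α : DForm E M p) : (c • α).d = c • α.d := by
  funext x
  change ofCoordAt x (extDeriv (c • α.coord x) _) = _
  rw [extDeriv_smul]
  rfl

theorem DForm.d_add {p : ℕ} {α β : DForm E M p} (hα : α.IsSmooth) (hβ : β.IsSmooth) :
    (α + β).d = α.d + β.d := by
  funext x
  have hx := mem_extChartAt_target (I := 𝓘(ℝ, E)) x
  change ofCoordAt x (extDeriv (α.coord x + β.coord x) _) = _
  rw [extDeriv_add (hα.differentiableAt hx) (hβ.differentiableAt hx)]
  rfl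

theorem DForm.d_zero {p : ℕ} : (0 : DForm E M p).d = 0 := by
  simpa using DForm.d_smul (0 : ℝ) (0 : DForm E M p)

theorem DForm.lie_smul {p : ℕ} (v : VField E M) (c : ℝ) (α : DForm E M p) :
    (c • α).lie v = c • α.lie v := by
  funext x
  change ofCoordAt x (lieDeriv (v.coord x) (c • α.coord x) _) = _
  rw [lieDeriv_smul]
  rfl

theorem DForm.lie_add {p : ℕ} (v : VField E M) {α β : DForm E M p} (hα : α.IsSmooth)
    (hβ : β.IsSmooth) : (α + β).lie v = α.lie v + β.lie v := by
  funext x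
  have hx := mem_extChartAt_target (I := 𝓘(ℝ, E)) x
  change ofCoordAt x (lieDeriv (v.coord x) (α.coord x + β.coord x) _) = _
  rw [lieDeriv_add (hα.differentiableAt hx) (hβ.differentiableAt hx)]
  rfl

theorem DForm.lie_zero {p : ℕ} (v : VField E M) : (0 : DForm E M p).lie v = 0 := by
  simpa using DForm.lie_smul v (0 : ℝ) (0 : DForm E M p)

theorem DForm.homog_self {p : ℕ} (α : DForm E M p) : α.homog p = α := Pi.single_eq_same p α

theorem DForm.homog_of_ne {p q : ℕ} (α : DForm E M p) (h : q ≠ p) : α.homog q = 0 :=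
  Pi.single_eq_of_ne h α

theorem DForm.homog_zero {p : ℕ} : (0 : DForm E M p).homog = 0 := Pi.single_zero p

theorem DForm.homog_add {p : ℕ} (α β : DForm E M p) : (α + β).homog = α.homog + β.homog :=
  Pi.single_add p α β

theorem DForm.homog_smul {p : ℕ} (c : ℝ) (α : DForm E M p) : (c • α).homog = c • α.homog :=
  Pi.single_smul p c α

theorem DForm.IsSmooth.homog {p : ℕ} {α : DForm E M p} (hα : α.IsSmooth) : α.homog.IsSmooth := by
  intro q
  by_cases h : q = p
  · subst h
    rwa [DForm.homog_self]
  · rw [DForm.homog_of_ne _ h]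
    exact .zero

theorem GForm.homog_component {α : GForm E M} {q : ℕ} (h : ∀ p, p ≠ q → α p = 0) :
    (α q).homog = α := by
  funext p
  by_cases hp : p = q
  · subst hp
    exact DForm.homog_self _
  · rw [DForm.homog_of_ne _ hp, h p hp]

theorem GForm.IsSmooth.zero : (0 : GForm E M).IsSmooth := fun _ => DForm.IsSmooth.zero

theorem GForm.IsSmooth.add {α β : GForm E M} (hα : α.IsSmooth) (hβ : β.IsSmooth) :
    (α + β).IsSmooth := fun p => (hα p).add (hβ p)

theorem GForm.IsSmooth.smul (c : ℝ) {α : GForm E M} (hα : α.IsSmooth) : (c • α).IsSmooth :=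
  fun p => (hα p).smul c

theorem GForm.d_smul (c : ℝ) (α : GForm E M) : (c • α).d = c • α.d := by
  funext p
  cases p with
  | zero => exact (smul_zero c).symm
  | succ p => exact DForm.d_smul c (α p)

theorem GForm.d_add {α β : GForm E M} (hα : α.IsSmooth) (hβ : β.IsSmooth) :
    (α + β).d = α.d + β.d := by
  funext p
  cases p with
  | zero => exact (add_zero _).symm
  | succ p => exact DForm.d_add (hα p) (hβ p)

theorem GForm.d_zero : (0 : GForm E M).d = 0 := by
  simpa using GForm.d_smul (0 : ℝ) (0 : GForm E M)

theorem GForm.d_homog_component (α : GForm E M) (p : ℕ) :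
    (α p).homog.d = (α.d (p + 1)).homog := by
  funext q
  cases q with
  | zero => exact (DForm.homog_of_ne _ (by omega)).symm
  | succ q =>
    change ((α p).homog q).d = _
    by_cases h : q = p
    · subst h
      rw [DForm.homog_self, DForm.homog_self]
      rfl
    · rw [DForm.homog_of_ne _ h, DForm.homog_of_ne _ (by omega), DForm.d_zero]

theorem GForm.lie_smul (v : VField E M) (c : ℝ) (α : GForm E M) : (c • α).lie v = c • α.lie v :=
  funext fun p => DForm.lie_smul v c (α p)

theorem GForm.lie_add (v : VField E M) {α β : GForm E M} (hα : α.IsSmooth) (hβ : β.IsSmooth) :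
    (α + β).lie v = α.lie v + β.lie v :=
  funext fun p => DForm.lie_add v (hα p) (hβ p)

theorem GForm.lie_zero (v : VField E M) : (0 : GForm E M).lie v = 0 :=
  funext fun _ => DForm.lie_zero v

theorem DForm.lie_homog {p : ℕ} (v : VField E M) (α : DForm E M p) :
    α.homog.lie v = (α.lie v).homog := by
  funext q
  change (α.homog q).lie v = _
  by_cases h : q = p
  · subst h
    rw [DForm.homog_self, DForm.homog_self]
  · rw [DForm.homog_of_ne _ h, DForm.homog_of_ne _ h, DForm.lie_zero]

/-- Each contraction lowers the degree by one, so a `k`-fold contraction of `ω` lives only in degree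
`n + 1 - k`. -/
theorem GForm.contract_apply_eq_zero {k p : ℕ} (v : Fin k → VField E M) {α : GForm E M}
    (h : α (p + k) = 0) : GForm.contract k v α p = 0 := by
  induction k generalizing α with
  | zero => exact h
  | succ k ih =>
    refine ih _ ?_
    change (α (p + (k + 1))).ι (v 0) = 0
    rw [h]
    rfl

theorem GForm.contract_two (v : Fin 2 → VField E M) (α : GForm E M) :
    GForm.contract 2 v α = (α.ι (v 0)).ι (v 1) := rfl

theorem GForm.ι_add_left (v w : VField E M) (α : GForm E M) :
    α.ι (v + w) = α.ι v + α.ι w := by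
  funext p x
  exact (α (p + 1) x).toAlternatingMap.curryLeft.map_add (v x) (w x) |> fun h =>
    ContinuousAlternatingMap.ext fun u => congrArg (fun f => f u) h

theorem GForm.ι_smul_left (c : ℝ) (v : VField E M) (α : GForm E M) :
    α.ι (c • v) = c • α.ι v := by
  funext p x
  exact (α (p + 1) x).toAlternatingMap.curryLeft.map_smul c (v x) |> fun h =>
    ContinuousAlternatingMap.ext fun u => congrArg (fun f => f u) h

theorem strictConserved_subset_globConserved (v : VField E M) :
    strictConserved v ⊆ globConserved v := fun _ h =>
  ⟨h.1, 0, .zero, by rw [h.2, GForm.d_zero]⟩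

variable [IsManifold 𝓘(ℝ, E) ((⊤ : ℕ∞) : WithTop ℕ∞) M]

theorem GForm.IsSmooth.d {α : GForm E M} (hα : α.IsSmooth) : α.d.IsSmooth := by
  intro p
  cases p with
  | zero => exact DForm.IsSmooth.zero
  | succ p => exact (hα p).d

theorem GForm.d_d {α : GForm E M} (hα : α.IsSmooth) : α.d.d = 0 := by
  funext p
  match p with
  | 0 => rfl
  | 1 => exact DForm.d_zero
  | p + 2 => exact DForm.d_d (hα p)

theorem GForm.IsSmooth.ι {α : GForm E M} (hα : α.IsSmooth) {v : VField E M} (hv : v.IsSmooth) :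
    (α.ι v).IsSmooth := fun p => (hα (p + 1)).ι hv

/-- Cartan's formula. -/
theorem GForm.lie_eq {α : GForm E M} (hα : α.IsSmooth) {v : VField E M} (hv : v.IsSmooth) :
    α.lie v = (α.ι v).d + α.d.ι v := by
  funext p
  cases p with
  | zero => exact (DForm.lie_zero_form v).trans (zero_add _).symm
  | succ p => exact DForm.lie_eq (hα (p + 1)) hv

theorem GForm.lie_ι {α : GForm E M} (hα : α.IsSmooth) (v : VField E M) {w : VField E M}
    (hw : w.IsSmooth) :
    (α.ι w).lie v = α.ι (VectorField.mlieBracket 𝓘(ℝ, E) v w) + (α.lie v).ι w :=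
  funext fun p => DForm.lie_ι (hα (p + 1)) v hw

/-- The Lie derivative commutes with the exterior derivative. -/
theorem GForm.lie_d {α : GForm E M} (hα : α.IsSmooth) {v : VField E M} (hv : v.IsSmooth) :
    α.d.lie v = (α.lie v).d := by
  rw [GForm.lie_eq hα.d hv, GForm.lie_eq hα hv, GForm.d_add (hα.ι hv).d (hα.d.ι hv),
    GForm.d_d (hα.ι hv), GForm.d_d hα, GForm.ι_zero, add_zero, zero_add]

theorem GForm.IsSmooth.contract {k : ℕ} {v : Fin k → VField E M} (hv : ∀ j, (v j).IsSmooth)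
    {α : GForm E M} (hα : α.IsSmooth) : (GForm.contract k v α).IsSmooth := by
  induction k generalizing α with
  | zero => exact hα
  | succ k ih => exact ih (fun j => hv j.succ) (hα.ι (hv 0))

/-- An iterated contraction of a `v`-invariant form is `v`-invariant if its contractions with the
brackets of `v` and the given fields vanish. -/
theorem GForm.lie_contract_eq_zero {k : ℕ} {v : VField E M} {w : Fin k → VField E M}
    (hw : ∀ j, (w j).IsSmooth) {α : GForm E M} (hα : α.IsSmooth) (hvα : α.lie v = 0)
    (hvw : ∀ j, α.ι (VectorField.mlieBracket 𝓘(ℝ, E) v (w j)) = 0) :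
    (GForm.contract k w α).lie v = 0 := by
  induction k generalizing α with
  | zero => exact hvα
  | succ k ih =>
    refine ih (fun j => hw j.succ) (hα.ι (hw 0)) ?_ fun j => ?_
    · rw [GForm.lie_ι hα v (hw 0), hvw, hvα, GForm.ι_zero, add_zero]
    -- Contractions anticommute, so the vanishing hypothesis passes from `α` to `α.ι (w 0)`.
    · rw [GForm.ι_comm]
      change -((α.ι (VectorField.mlieBracket 𝓘(ℝ, E) v (w j.succ))).ι (w 0)) = 0
      rw [hvw, GForm.ι_zero, neg_zero]

theorem VField.IsSmooth.zero : (0 : VField E M).IsSmooth :=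
  Bundle.contMDiff_zeroSection ℝ (TangentSpace 𝓘(ℝ, E) : M → Type _)

theorem VField.IsSmooth.add {v w : VField E M} (hv : v.IsSmooth) (hw : w.IsSmooth) :
    (v + w).IsSmooth := ContMDiff.add_section hv hw

theorem VField.IsSmooth.smul (c : ℝ) {v : VField E M} (hv : v.IsSmooth) : (c • v).IsSmooth :=
  ContMDiff.const_smul_section hv

end Forms

/-! ### Observables and their brackets -/

section Observables

variable {E : Type*} [NormedAddCommGroup E] [NormedSpace ℝ E]
  {M : Type*} [TopologicalSpace M] [ChartedSpace E M]
  [IsManifold 𝓘(ℝ, E) ((⊤ : ℕ∞) : WithTop ℕ∞) M]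
  {n : ℕ} {ω : DForm E M (n + 1)}

/-- The zero field is Hamiltonian for any closed form. -/
theorem IsHamiltonian.of_d_eq_zero {α : DForm E M (n - 1)} (hα : α.IsSmooth)
    (h : α.homog.d = 0) : IsHamiltonian ω α := by
  refine ⟨hα, 0, VField.IsSmooth.zero, ?_⟩
  have h0 := GForm.ι_smul_left (0 : ℝ) 0 ω.homog
  rw [zero_smul, zero_smul] at h0
  rw [h, h0, neg_zero]

theorem IsHamiltonian.zero : IsHamiltonian ω 0 :=
  .of_d_eq_zero .zero (by rw [DForm.homog_zero, GForm.d_zero])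

theorem IsHamiltonian.add {α β : DForm E M (n - 1)} (hα : IsHamiltonian ω α)
    (hβ : IsHamiltonian ω β) : IsHamiltonian ω (α + β) := by
  obtain ⟨hα, v, hv, hvα⟩ := hα
  obtain ⟨hβ, w, hw, hwβ⟩ := hβ
  refine ⟨hα.add hβ, v + w, hv.add hw, ?_⟩
  rw [DForm.homog_add, GForm.d_add hα.homog hβ.homog, hvα, hwβ, GForm.ι_add_left, neg_add]

theorem IsHamiltonian.smul (c : ℝ) {α : DForm E M (n - 1)} (hα : IsHamiltonian ω α) :
    IsHamiltonian ω (c • α) := by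
  obtain ⟨hα, v, hv, hvα⟩ := hα
  refine ⟨hα.smul c, c • v, hv.smul c, ?_⟩
  rw [DForm.homog_smul, GForm.d_smul, hvα, GForm.ι_smul_left, smul_neg]

theorem IsHamiltonian.isHamiltonianField_hamField {α : DForm E M (n - 1)}
    (hα : IsHamiltonian ω α) : IsHamiltonianField ω α (hamField ω α) := by
  rw [hamField, dif_pos hα.2]
  exact hα.2.choose_spec

/-- The Lie bracket of Hamiltonian fields is a Hamiltonian field of the contracted form. -/
theorem d_contract_two [CompleteSpace E] (hω : IsPrePlectic ω) {α β : DForm E M (n - 1)}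
    (hα : α.IsSmooth) (hβ : β.IsSmooth) {v w : VField E M} (hv : IsHamiltonianField ω α v)
    (hw : IsHamiltonianField ω β w) :
    ((ω.homog.ι v).ι w).d = -ω.homog.ι (VectorField.mlieBracket 𝓘(ℝ, E) v w) := by
  have hs := hω.1.homog
  have hd : ω.homog.d = 0 := by
    have h := GForm.d_homog_component ω.homog (n + 1)
    rw [DForm.homog_self] at h
    rw [h]
    change (DForm.d (ω.homog (n + 1))).homog = 0
    rw [DForm.homog_self, hω.2, DForm.homog_zero]
  have hι : ∀ {γ : DForm E M (n - 1)} {u : VField E M}, γ.IsSmooth →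
      IsHamiltonianField ω γ u → (ω.homog.ι u).d = 0 := by
    intro γ u hγ hu
    have h := GForm.d_d hγ.homog
    rw [hu.2, ← neg_one_smul ℝ, GForm.d_smul] at h
    simpa using h
  -- As `ι_v ω` is closed, `d ι_w ι_v ω = L_w ι_v ω = ι_{[w,v]} ω + ι_v L_w ω`. The last term
  -- vanishes because `ω` and `ι_w ω` are closed; antisymmetry of the bracket gives the sign.
  have h1 := GForm.lie_eq (hs.ι hv.1) hw.1
  rw [hι hα hv, GForm.ι_zero, add_zero] at h1
  rw [← h1, GForm.lie_ι hs w hv.1, GForm.lie_eq hs hw.1, hι hβ hw, hd, GForm.ι_zero, add_zero,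
    GForm.ι_zero, add_zero, VectorField.mlieBracket_swap, ← neg_one_smul ℝ, GForm.ι_smul_left]
  exact neg_one_smul ℝ (ω.homog.ι (VectorField.mlieBracket 𝓘(ℝ, E) v w))

theorem zero_mem_observables : (0 : GForm E M) ∈ observables ω :=
  ⟨.zero, fun _ _ => rfl, IsHamiltonian.zero⟩

theorem add_mem_observables {α β : GForm E M} (hα : α ∈ observables ω) (hβ : β ∈ observables ω) :
    α + β ∈ observables ω :=
  ⟨hα.1.add hβ.1, fun p hp => by rw [Pi.add_apply, hα.2.1 p hp, hβ.2.1 p hp, add_zero],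
    hα.2.2.add hβ.2.2⟩

theorem smul_mem_observables (c : ℝ) {α : GForm E M} (hα : α ∈ observables ω) :
    c • α ∈ observables ω :=
  ⟨hα.1.smul c, fun p hp => by rw [Pi.smul_apply, hα.2.1 p hp, smul_zero], hα.2.2.smul c⟩

theorem homog_mem_observables {α : GForm E M} (hα : α ∈ observables ω) (p : ℕ) :
    (α p).homog ∈ observables ω := by
  refine ⟨(hα.1 p).homog, fun q hq => ?_, ?_⟩
  · by_cases h : q = p
    · subst h
      rw [DForm.homog_self, hα.2.1 q hq]
    · exact DForm.homog_of_ne _ h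
  · by_cases h : n - 1 = p
    · subst h
      rw [DForm.homog_self]
      exact hα.2.2
    · rw [DForm.homog_of_ne _ h]
      exact .zero

/-- For `k ≥ 2`, `l_k` has form degree `n + 1 - k`, which equals `n - 1` only for `k = 2`; beyond
that the Hamiltonian condition concerns the zero form. -/
theorem bracket_mem_observables [CompleteSpace E] (hn : 1 ≤ n) (hω : IsPrePlectic ω) {k : ℕ}
    {β : Fin k → GForm E M} (hβ : ∀ j, β j ∈ observables ω) : bracket ω k β ∈ observables ω := by
  match k, β, hβ with
  | 0, _, _ => exact zero_mem_observables
  | 1, β, hβ =>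
    refine ⟨fun p => ?_, fun p hp => if_neg (by omega), ?_⟩
    · by_cases h : p < n
      · simpa only [bracket, if_pos h] using (hβ 0).1.d p
      · simpa only [bracket, if_neg h] using DForm.IsSmooth.zero
    · have h : bracket ω 1 β (n - 1) = (β 0).d (n - 1) := if_pos (by omega)
      rw [h]
      refine .of_d_eq_zero ((hβ 0).1.d _) ?_
      rw [GForm.d_homog_component, GForm.d_d (hβ 0).1]
      exact DForm.homog_zero
  | k + 2, β, hβ =>
    have hH := fun j => (hβ j).2.2.isHamiltonianField_hamField
    have hz : ∀ p, p + (k + 2) ≠ n + 1 → bracket ω (k + 2) β p = 0 := fun p hp => by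
      change bracketSign (k + 2) • GForm.contract (k + 2) _ ω.homog p = 0
      rw [GForm.contract_apply_eq_zero _ (DForm.homog_of_ne _ hp), smul_zero]
    have hs : (bracket ω (k + 2) β).IsSmooth :=
      .smul _ (.contract (fun j => (hH j).1) hω.1.homog)
    refine ⟨hs, fun p hp => hz p (by omega), ?_⟩
    cases k with
    | succ k =>
      rw [hz _ (by omega)]
      exact .zero
    | zero =>
      -- Because `ς(2) = 1`, the bracket of the two Hamiltonian fields serves without a sign change.
      refine ⟨hs _, VectorField.mlieBracket 𝓘(ℝ, E) _ _, (hH 0).1.mlieBracket (hH 1).1, ?_⟩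
      rw [GForm.homog_component fun p hp => hz p (by omega),
        ← d_contract_two hω (hβ 0).2.2.1 (hβ 1).2.2.1 (hH 0) (hH 1)]
      have h : bracketSign 2 = 1 := by norm_num [bracketSign]
      change (bracketSign 2 • GForm.contract 2 _ ω.homog).d = _
      rw [h, one_smul, GForm.contract_two]

/-- Brackets of locally conserved observables are strictly conserved. -/
theorem lie_bracket_eq_zero (hω : IsPrePlectic ω) {v : VField E M} (hv : v.IsSmooth)
    (hvω : ω.lie v = 0) {k : ℕ} {β : Fin k → GForm E M}
    (hβ : ∀ j, β j ∈ observables ω ∩ locConserved v) : (bracket ω k β).lie v = 0 := by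
  match k, β, hβ with
  | 0, _, _ => exact GForm.lie_zero v
  | 1, β, hβ =>
    have h : (β 0).d.lie v = 0 := by rw [GForm.lie_d (hβ 0).2.1 hv, (hβ 0).2.2]
    funext p
    by_cases hp : p < n
    · have h1 : bracket ω 1 β p = (β 0).d p := if_pos hp
      change DForm.lie v (bracket ω 1 β p) = 0
      rw [h1]
      exact congrFun h p
    · have h1 : bracket ω 1 β p = 0 := if_neg hp
      change DForm.lie v (bracket ω 1 β p) = 0
      rw [h1, DForm.lie_zero]
  | k + 2, β, hβ =>
    have hH := fun j => (hβ j).1.2.2.isHamiltonianField_hamField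
    have hs := hω.1.homog
    have hl : ω.homog.lie v = 0 := by rw [DForm.lie_homog, hvω, DForm.homog_zero]
    rw [bracket, GForm.lie_smul, GForm.lie_contract_eq_zero (fun j => (hH j).1) hs hl, smul_zero]
    intro j
    -- With `L_v ω = 0` this reads `L_v ι_{w_j} ω = ι_{[v,w_j]} ω`. The left side is `-d L_v` of the
    -- degree-`0` part of `β j`, hence zero.
    have h1 := GForm.lie_ι hs v (hH j).1
    have h2 : ω.homog.ι (hamField ω (β j (n - 1))) = (-1 : ℝ) • (β j (n - 1)).homog.d := by
      rw [(hH j).2, smul_neg]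
      exact (neg_eq_iff_eq_neg.2 (neg_one_smul ℝ _)).symm
    have h3 : ((β j (n - 1)).homog.lie v).d = 0 := by
      rw [DForm.lie_homog]
      change (((β j).lie v) (n - 1)).homog.d = 0
      rw [GForm.d_homog_component, (hβ j).2.2]
      exact DForm.homog_zero
    rw [hl, GForm.ι_zero, add_zero, h2, GForm.lie_smul, GForm.lie_d ((hβ j).2.1 _).homog hv, h3,
      smul_zero] at h1
    exact h1.symm

theorem globConserved_subset_locConserved (v : VField E M) :
    globConserved v ⊆ locConserved v := fun _ ⟨h, _, hγ, hd⟩ =>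
  ⟨h, by rw [hd, GForm.d_d hγ]⟩

/-- A graded linear space of locally conserved forms that contains the strictly conserved ones
cuts out an `L_∞`-subalgebra. -/
theorem isLInftySubalgebra_inter [CompleteSpace E] (hn : 1 ≤ n) (hω : IsPrePlectic ω)
    {v : VField E M} (hv : v.IsSmooth) (hvω : ω.lie v = 0) {S : Set (GForm E M)}
    (hS : strictConserved v ⊆ S) (hS' : S ⊆ locConserved v)
    (hadd : ∀ α ∈ S, ∀ β ∈ S, α + β ∈ S) (hsmul : ∀ c : ℝ, ∀ α ∈ S, c • α ∈ S)
    (hhom : ∀ α ∈ S, ∀ p : ℕ, (α p).homog ∈ S) :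
    IsLInftySubalgebra ω (observables ω ∩ S) where
  subset := Set.inter_subset_left
  zero_mem := ⟨zero_mem_observables, hS ⟨.zero, GForm.lie_zero v⟩⟩
  add_mem α hα β hβ := ⟨add_mem_observables hα.1 hβ.1, hadd α hα.2 β hβ.2⟩
  smul_mem c α hα := ⟨smul_mem_observables c hα.1, hsmul c α hα.2⟩
  component_mem α hα p := ⟨homog_mem_observables hα.1 p, hhom α hα.2 p⟩
  bracket_mem k _ β hβ := by
    have h := bracket_mem_observables hn hω fun j => (hβ j).1
    exact ⟨h, hS ⟨h.1, lie_bracket_eq_zero hω hv hvω fun j => ⟨(hβ j).1, hS' (hβ j).2⟩⟩⟩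

/-! ### The three subalgebras -/

theorem GForm.IsSmooth.lie {α : GForm E M} (hα : α.IsSmooth) {v : VField E M} (hv : v.IsSmooth) :
    (α.lie v).IsSmooth := by
  rw [GForm.lie_eq hα hv]
  exact (hα.ι hv).d.add (hα.d.ι hv)

theorem isLInftySubalgebra_locConserved [CompleteSpace E] (hn : 1 ≤ n) (hω : IsPrePlectic ω)
    {v : VField E M} (hv : v.IsSmooth) (hvω : ω.lie v = 0) :
    IsLInftySubalgebra ω (observables ω ∩ locConserved v) := by
  refine isLInftySubalgebra_inter hn hω hv hvω ((strictConserved_subset_globConserved v).trans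
    (globConserved_subset_locConserved v)) subset_rfl ?_ ?_ ?_
  · rintro α ⟨hα, h⟩ β ⟨hβ, h'⟩
    refine ⟨hα.add hβ, ?_⟩
    rw [GForm.lie_add v hα hβ, GForm.d_add (hα.lie hv) (hβ.lie hv), h, h', add_zero]
  · rintro c α ⟨hα, h⟩
    exact ⟨hα.smul c, by rw [GForm.lie_smul, GForm.d_smul, h, smul_zero]⟩
  · rintro α ⟨hα, h⟩ p
    refine ⟨(hα p).homog, ?_⟩
    rw [DForm.lie_homog]
    change ((α.lie v) p).homog.d = 0
    rw [GForm.d_homog_component, h]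
    exact DForm.homog_zero

theorem isLInftySubalgebra_globConserved [CompleteSpace E] (hn : 1 ≤ n) (hω : IsPrePlectic ω)
    {v : VField E M} (hv : v.IsSmooth) (hvω : ω.lie v = 0) :
    IsLInftySubalgebra ω (observables ω ∩ globConserved v) := by
  refine isLInftySubalgebra_inter hn hω hv hvω (strictConserved_subset_globConserved v)
    (globConserved_subset_locConserved v) ?_ ?_ ?_
  · rintro α ⟨hα, γ, hγ, h⟩ β ⟨hβ, δ, hδ, h'⟩
    exact ⟨hα.add hβ, γ + δ, hγ.add hδ, by rw [GForm.lie_add v hα hβ, GForm.d_add hγ hδ, h, h']⟩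
  · rintro c α ⟨hα, γ, hγ, h⟩
    exact ⟨hα.smul c, c • γ, hγ.smul c, by rw [GForm.lie_smul, GForm.d_smul, h]⟩
  · rintro α ⟨hα, γ, hγ, h⟩ p
    have hl : (α p).homog.lie v = (γ.d p).homog := by
      rw [DForm.lie_homog, ← h]
      rfl
    -- A primitive of the component in degree `p + 1` is `γ p`; an exact form has no component in
    -- degree `0`, so there the primitive `0` works.
    cases p with
    | zero => exact ⟨(hα 0).homog, 0, .zero, hl.trans (DForm.homog_zero.trans GForm.d_zero.symm)⟩
    | succ p =>
      exact ⟨(hα _).homog, (γ p).homog, (hγ p).homog,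
        hl.trans (GForm.d_homog_component γ p).symm⟩

theorem isLInftySubalgebra_strictConserved [CompleteSpace E] (hn : 1 ≤ n) (hω : IsPrePlectic ω)
    {v : VField E M} (hv : v.IsSmooth) (hvω : ω.lie v = 0) :
    IsLInftySubalgebra ω (observables ω ∩ strictConserved v) := by
  refine isLInftySubalgebra_inter hn hω hv hvω subset_rfl
    ((strictConserved_subset_globConserved v).trans (globConserved_subset_locConserved v)) ?_ ?_ ?_
  · rintro α ⟨hα, h⟩ β ⟨hβ, h'⟩
    exact ⟨hα.add hβ, by rw [GForm.lie_add v hα hβ, h, h', add_zero]⟩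
  · rintro c α ⟨hα, h⟩
    exact ⟨hα.smul c, by rw [GForm.lie_smul, h, smul_zero]⟩
  · rintro α ⟨hα, h⟩ p
    refine ⟨(hα p).homog, ?_⟩
    rw [DForm.lie_homog]
    exact (congrArg DForm.homog (congrFun h p)).trans DForm.homog_zero

end Observables

end Multisymplectic

end

theorem mainTheorem7
    {E : Type*} [NormedAddCommGroup E] [NormedSpace ℝ E] [FiniteDimensional ℝ E]
    {M : Type*} [TopologicalSpace M] [ChartedSpace E M]
    [IsManifold 𝓘(ℝ, E) ((⊤ : ℕ∞) : WithTop ℕ∞) M]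
    (n : ℕ) (hn : 1 ≤ n)
    (ω : Multisymplectic.DForm E M (n + 1)) (hω : Multisymplectic.IsPrePlectic ω)
    (v : Multisymplectic.VField E M) (hv : v.IsSmooth) (hvω : ω.lie v = 0) :
    Multisymplectic.IsLInftySubalgebra ω
        (Multisymplectic.observables ω ∩ Multisymplectic.locConserved v) ∧
      Multisymplectic.IsLInftySubalgebra ω
        (Multisymplectic.observables ω ∩ Multisymplectic.globConserved v) ∧
      Multisymplectic.IsLInftySubalgebra ω
        (Multisymplectic.observables ω ∩ Multisymplectic.strictConserved v) ∧
      ∀ k : ℕ, 1 ≤ k → ∀ β : Fin k → Multisymplectic.GForm E M,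
        (∀ j, β j ∈ Multisymplectic.observables ω ∩ Multisymplectic.locConserved v) →
          (Multisymplectic.bracket ω k β).lie v = 0 := by
  -- Completeness enters through smoothness of the Lie bracket of smooth fields, needed for `l₂`.
  have : CompleteSpace E := FiniteDimensional.complete ℝ E
  exact ⟨Multisymplectic.isLInftySubalgebra_locConserved hn hω hv hvω,
    Multisymplectic.isLInftySubalgebra_globConserved hn hω hv hvω,
    Multisymplectic.isLInftySubalgebra_strictConserved hn hω hv hvω,
    fun _ _ _ hβ => Multisymplectic.lie_bracket_eq_zero hω hv hvω hβ⟩
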